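/- Let $X_1,\dots,X_n$ be independent random variables with values in a measurable space $\mathcal X$, let $F:\mathcal X^n\to\mathbb R$ be measurable and $Z=F(X_1,\dots,X_n)$. For each $i=1,\dots,n$ let $Z_i=F_i(X_1,\dots,X_{i-1},X_{i+1},\dots,X_n)$ for some measurable $F_i:\mathcal X^{n-1}\to\mathbb R$. Write $x_+=\max(x,0)$, $x_-=\max(-x,0)$, $\|Y\|_q=(\mathbb E|Y|^q)^{1/q}$ and $\kappa=\frac{\sqrt e}{2(\sqrt e-1)}$. Assume that, almost surely, $0\le Z-Z_i\le 1$ for all $i=1,\dots,n$ and that, for some constant $A\ge 1$, almost surely $$0\le\sum_{i=1}^n (Z-Z_i)\le AZ .$$ Then for all integers $q\ge 1$, $$\|Z\|_q\le \mathbb E[Z]+A\,\frac{q-1}{2},$$ and for every real $q\ge 2$, $$\|(Z-\mathbb E[Z])_+\|_q\le\sqrt{\kappa}\left[\sqrt{Aq\,\mathbb E[Z]}+\frac{Aq}{2}\right].$$ Moreover, for all integers $q\ge 2$, $$\|(Z-\mathbb E[Z])_-\|_q\le\sqrt{C\,q\,A\,\mathbb E[Z]},$$ where $0<C<1.131$ is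 a universal constant, which does not depend on $n$, $q$, $A$, $F$, the $F_i$ or the law of the $X_i$. -/

import Mathlib

open MeasureTheory ProbabilityTheory

/-- The constant `κ = √e / (2 (√e - 1))`. -/
noncomputable def kappa : ℝ :=
  Real.sqrt (Real.exp 1) / (2 * (Real.sqrt (Real.exp 1) - 1))

/-- The random variable `Z = F (X₁, …, Xₙ)`. -/
def fullValue {Ω : Type*} {S : Type*} {n : ℕ}
    (F : (Fin n → S) → ℝ) (X : Fin n → Ω → S) : Ω → ℝ :=
  fun ω => F (fun j => X j ω)

/-- The random variable `Zᵢ = Fᵢ (X₁, …, Xᵢ₋₁, Xᵢ₊₁, …, Xₙ)`: the function `Fᵢ` takes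
a vector indexed by the indices different from `i`. -/
def leaveOneOutValue {Ω : Type*} {S : Type*} {n : ℕ} (i : Fin n)
    (Fi : ({j : Fin n // j ≠ i} → S) → ℝ) (X : Fin n → Ω → S) : Ω → ℝ :=
  fun ω => Fi (fun j => X j.1 ω)

/-! Everything rests on the `φ`-entropy `E φ(f) - φ(E f)` of a function of independent variables.
When the Bregman divergence of `φ` is jointly convex, this entropy is at most the sum over `i` of
the mean divergence of `f` from any `u i` that ignores coordinate `i`
(`HasConvexBregman.entropy_le_sum_bregman`).

Moments: for `φ(x) = x ^ (1 + 1/(N+1))` and the function `f ^ (N+1)`, self-boundedness turns this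
into a recursion from the moment of order `N+1` to that of order `N+2`, solved by Bernoulli's
inequality (`integral_pow_le`).

Deviations: for `φ(x) = x log x` and `exp (t f)`, it becomes a differential inequality for the
log-Laplace transform (Herbst's argument). Its integration gives, with `E` the mean of `f`, the
bounds `E t / (1 - A t / 2)` at `t > 0` and `-E s (1 - A s / 2)` at `-s < 0`. A suitable `t` in `y₊
≤ (q/t) exp (t y / q - 1)` converts them into moment bounds, with room to spare: the factor `√κ ≥ 1`
is not needed and `C = 1` is enough.

No integrability is assumed: the condition `0 ≤ Z - Zᵢ ≤ 1` already makes `Z` almost surely bounded,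
so `F` and the `u i` can be truncated. -/

/-! ### Jointly convex Bregman divergences and tensorization of entropy. -/

/-- The Bregman divergence of a function `φ` with derivative `φ'`. -/
def bregman (φ φ' : ℝ → ℝ) (a b : ℝ) : ℝ := φ a - φ b - φ' b * (a - b)

/-- Convex functions `φ` on `(0, ∞)`, with derivative `φ'`, whose Bregman divergence is jointly
convex, in the form of supporting planes. -/
structure HasConvexBregman (φ φ' : ℝ → ℝ) : Prop where
  measurable : Measurable φ
  measurable_deriv : Measurable φ'
  bounded : ∀ m M : ℝ, 0 < m → ∃ K, ∀ x ∈ Set.Icc m M, |φ x| ≤ K ∧ |φ' x| ≤ K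
  nonneg : ∀ a b : ℝ, 0 < a → 0 < b → 0 ≤ bregman φ φ' a b
  exists_support : ∀ A B : ℝ, 0 < A → 0 < B → ∃ α β : ℝ, ∀ a b : ℝ, 0 < a → 0 < b →
    bregman φ φ' A B + α * (a - A) + β * (b - B) ≤ bregman φ φ' a b

theorem integral_mem_Icc {α : Type*} [MeasurableSpace α] {μ : Measure α} [IsProbabilityMeasure μ]
    {f : α → ℝ} (hf : Measurable f) {m M : ℝ} (hm : ∀ x, f x ∈ Set.Icc m M) :
    ∫ x, f x ∂μ ∈ Set.Icc m M := by
  have hi : Integrable f μ := .of_mem_Icc m M hf.aemeasurable (.of_forall hm)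
  constructor
  · simpa using integral_mono (integrable_const m) hi (fun x => (hm x).1)
  · simpa using integral_mono hi (integrable_const M) (fun x => (hm x).2)

theorem measurePreserving_cons {S : Type*} [MeasurableSpace S] {n : ℕ}
    (μ : Fin (n + 1) → Measure S) [∀ i, SigmaFinite (μ i)] :
    MeasurePreserving (fun p : S × (Fin n → S) => (Fin.cons p.1 p.2 : Fin (n + 1) → S))
      ((μ 0).prod (Measure.pi fun j => μ j.succ)) (Measure.pi μ) := by
  have := (measurePreserving_piFinSuccAbove μ 0).symm
  have e : ⇑(MeasurableEquiv.piFinSuccAbove (fun _ : Fin (n + 1) => S) 0).symm =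
      fun p : S × (Fin n → S) => (Fin.cons p.1 p.2 : Fin (n + 1) → S) := by
    funext p
    simp [MeasurableEquiv.piFinSuccAbove, Fin.insertNthEquiv]
  rw [e] at this
  simpa only [Fin.zero_succAbove] using this

namespace HasConvexBregman

variable {φ φ' : ℝ → ℝ} {α : Type*} [MeasurableSpace α]

theorem measurable_bregman (h : HasConvexBregman φ φ') {f g : α → ℝ} (hf : Measurable f)
    (hg : Measurable g) : Measurable fun x => bregman φ φ' (f x) (g x) := by
  have h1 := h.measurable.comp hf
  have h2 := h.measurable.comp hg
  have h3 := h.measurable_deriv.comp hg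
  exact (h1.sub h2).sub (h3.mul (hf.sub hg))

theorem bounded_bregman (h : HasConvexBregman φ φ') {m M : ℝ} (hm : 0 < m) :
    ∃ K, ∀ x ∈ Set.Icc m M, ∀ y ∈ Set.Icc m M, |bregman φ φ' x y| ≤ K := by
  obtain ⟨K, hK⟩ := h.bounded m M hm
  refine ⟨K + K + K * (M - m), fun x hx y hy => ?_⟩
  have h1 := (hK x hx).1
  have h2 := (hK y hy).1
  have h3 := (hK y hy).2
  have h4 : |x - y| ≤ M - m := abs_sub_le_iff.2 ⟨by linarith [hx.2, hy.1], by linarith [hx.1, hy.2]⟩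
  have h5 : |φ' y * (x - y)| ≤ K * (M - m) := by
    rw [abs_mul]
    exact mul_le_mul h3 h4 (abs_nonneg _) ((abs_nonneg _).trans h3)
  unfold bregman
  calc |φ x - φ y - φ' y * (x - y)| ≤ |φ x - φ y| + |φ' y * (x - y)| := abs_sub _ _
    _ ≤ |φ x| + |φ y| + |φ' y * (x - y)| := by gcongr; exact abs_sub _ _
    _ ≤ _ := by gcongr

variable {μ : Measure α} [IsProbabilityMeasure μ] {m M : ℝ}

theorem integrable_comp (h : HasConvexBregman φ φ') (hm : 0 < m) {f : α → ℝ} (hf : Measurable f)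
    (hfm : ∀ x, f x ∈ Set.Icc m M) : Integrable (fun x => φ (f x)) μ := by
  obtain ⟨K, hK⟩ := h.bounded m M hm
  exact .of_bound (h.measurable.comp hf).aestronglyMeasurable K
    (.of_forall fun x => (hK _ (hfm x)).1)

theorem integrable_bregman (h : HasConvexBregman φ φ') (hm : 0 < m) {f g : α → ℝ}
    (hf : Measurable f) (hg : Measurable g) (hfm : ∀ x, f x ∈ Set.Icc m M)
    (hgm : ∀ x, g x ∈ Set.Icc m M) : Integrable (fun x => bregman φ φ' (f x) (g x)) μ := by
  obtain ⟨K, hK⟩ := h.bounded_bregman hm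
  exact .of_bound (h.measurable_bregman hf hg).aestronglyMeasurable K
    (.of_forall fun x => hK _ (hfm x) _ (hgm x))

/-- Jensen's inequality in two variables: the linear terms of the supporting plane at the means
integrate to zero. -/
theorem bregman_integral_le (h : HasConvexBregman φ φ') (hm : 0 < m) {f g : α → ℝ}
    (hf : Measurable f) (hg : Measurable g) (hfm : ∀ x, f x ∈ Set.Icc m M)
    (hgm : ∀ x, g x ∈ Set.Icc m M) :
    bregman φ φ' (∫ x, f x ∂μ) (∫ x, g x ∂μ) ≤ ∫ x, bregman φ φ' (f x) (g x) ∂μ := by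
  have hfi : Integrable f μ := .of_mem_Icc m M hf.aemeasurable (.of_forall hfm)
  have hgi : Integrable g μ := .of_mem_Icc m M hg.aemeasurable (.of_forall hgm)
  set A := ∫ x, f x ∂μ
  set B := ∫ x, g x ∂μ
  have hA : 0 < A := hm.trans_le (integral_mem_Icc hf hfm).1
  have hB : 0 < B := hm.trans_le (integral_mem_Icc hg hgm).1
  obtain ⟨a, b, hab⟩ := h.exists_support A B hA hB
  have e1 : Integrable (fun x => a * (f x - A)) μ := (hfi.sub (integrable_const A)).const_mul a
  have e2 : Integrable (fun x => b * (g x - B)) μ := (hgi.sub (integrable_const B)).const_mul b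
  have key := integral_mono
    (f := fun x => bregman φ φ' A B + a * (f x - A) + b * (g x - B))
    (((integrable_const (bregman φ φ' A B)).add e1).add e2)
    (h.integrable_bregman (μ := μ) hm hf hg hfm hgm)
    (fun x => hab (f x) (g x) (hm.trans_le (hfm x).1) (hm.trans_le (hgm x).1))
  have e3 : ∫ x, a * (f x - A) ∂μ = 0 := by
    rw [integral_const_mul, integral_sub hfi (integrable_const A)]; simp [A]
  have e4 : ∫ x, b * (g x - B) ∂μ = 0 := by
    rw [integral_const_mul, integral_sub hgi (integrable_const B)]; simp [B]
  have e5 : ∫ x, bregman φ φ' A B + a * (f x - A) + b * (g x - B) ∂μ = bregman φ φ' A B := by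
    have e6 : Integrable (fun x => bregman φ φ' A B + a * (f x - A)) μ :=
      (integrable_const _).add e1
    rw [integral_add e6 e2, integral_add (integrable_const _) e1, e3, e4]
    simp
  rwa [e5] at key

/-- The two sides differ by exactly the divergence of `∫ f` from `c`. -/
theorem entropy_le_bregman_const (h : HasConvexBregman φ φ') (hm : 0 < m) {f : α → ℝ}
    (hf : Measurable f) (hfm : ∀ x, f x ∈ Set.Icc m M) {c : ℝ} (hc : c ∈ Set.Icc m M) :
    ∫ x, φ (f x) ∂μ - φ (∫ x, f x ∂μ) ≤ ∫ x, bregman φ φ' (f x) c ∂μ := by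
  have hfi : Integrable f μ := .of_mem_Icc m M hf.aemeasurable (.of_forall hfm)
  have hφ := h.integrable_comp (μ := μ) hm hf hfm
  have hn := h.nonneg (∫ x, f x ∂μ) c (hm.trans_le (integral_mem_Icc hf hfm).1)
    (hm.trans_le hc.1)
  have e : ∫ x, bregman φ φ' (f x) c ∂μ
      = ∫ x, φ (f x) ∂μ - φ c - φ' c * (∫ x, f x ∂μ - c) := by
    have e1 : Integrable (fun x => φ (f x) - φ c) μ := hφ.sub (integrable_const _)
    have e2 : Integrable (fun x => φ' c * (f x - c)) μ :=
      (hfi.sub (integrable_const _)).const_mul _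
    unfold bregman
    rw [integral_sub e1 e2, integral_sub hφ (integrable_const _), integral_const_mul,
      integral_sub hfi (integrable_const _)]
    simp
  rw [e]
  unfold bregman at hn
  linarith

/-- Tensorization of the `φ`-entropy. -/
theorem entropy_le_sum_bregman (h : HasConvexBregman φ φ') (hm : 0 < m) {S : Type*}
    [MeasurableSpace S] (n : ℕ) (μ : Fin n → Measure S) [∀ i, IsProbabilityMeasure (μ i)]
    (f : (Fin n → S) → ℝ) (u : Fin n → (Fin n → S) → ℝ) (hf : Measurable f)
    (hu : ∀ i, Measurable (u i)) (hfm : ∀ x, f x ∈ Set.Icc m M)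
    (hum : ∀ i x, u i x ∈ Set.Icc m M) (hui : ∀ i x s, u i (Function.update x i s) = u i x) :
    ∫ x, φ (f x) ∂(Measure.pi μ) - φ (∫ x, f x ∂(Measure.pi μ)) ≤
      ∑ i, ∫ x, bregman φ φ' (f x) (u i x) ∂(Measure.pi μ) := by
  induction n with
  | zero =>
    rw [Measure.pi_of_empty]
    simp [integral_dirac' _ _ hf.stronglyMeasurable]
  | succ n ih =>
    have hne : Nonempty S := (μ 0).nonempty_of_neZero
    obtain ⟨s₀⟩ := hne
    set ν : Measure (Fin n → S) := Measure.pi fun j => μ j.succ with hν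
    let c : S × (Fin n → S) → (Fin (n + 1) → S) := fun p => Fin.cons p.1 p.2
    have hmp : MeasurePreserving c ((μ 0).prod ν) (Measure.pi μ) := measurePreserving_cons μ
    have hc : Measurable c := hmp.measurable
    have hsec : ∀ x, Measurable fun y => c (x, y) := fun x => hc.comp measurable_prodMk_left
    have hint : ∀ g : (Fin (n + 1) → S) → ℝ, Measurable g → (∃ K, ∀ x, |g x| ≤ K) →
        ∫ x, g x ∂(Measure.pi μ) = ∫ x, ∫ y, g (c (x, y)) ∂ν ∂(μ 0) := by
      rintro g hg ⟨K, hK⟩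
      rw [← hmp.map_eq, integral_map hc.aemeasurable hg.aestronglyMeasurable,
        integral_prod]
      exact .of_bound (hg.comp hc).aestronglyMeasurable K (.of_forall fun x => hK _)
    obtain ⟨K, hK⟩ := h.bounded m M hm
    obtain ⟨K', hK'⟩ := h.bounded_bregman (M := M) hm
    have hmeas : ∀ g : (Fin (n + 1) → S) → ℝ, Measurable g →
        Measurable fun x => ∫ y, g (c (x, y)) ∂ν := fun g hg =>
      (StronglyMeasurable.integral_prod_right
        (f := fun x y => g (c (x, y))) (hg.comp hc).stronglyMeasurable).measurable
    have hintx : ∀ g : (Fin (n + 1) → S) → ℝ, Measurable g → ∀ K, (∀ x, |g x| ≤ K) →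
        Integrable (fun x => ∫ y, g (c (x, y)) ∂ν) (μ 0) := by
      intro g hg K hK
      refine .of_mem_Icc (-K) K (hmeas g hg).aemeasurable (.of_forall fun x => ?_)
      exact integral_mem_Icc (hg.comp (hsec x)) fun y => abs_le.1 (hK _)
    have hfM : ∀ x, |f x| ≤ M := fun x => abs_le.2 ⟨by linarith [(hfm x).1, (hfm x).2], (hfm x).2⟩
    set g : S → ℝ := fun x => ∫ y, f (c (x, y)) ∂ν with hg
    have hgmeas : Measurable g := hmeas f hf
    have hgm : ∀ x, g x ∈ Set.Icc m M := fun x => integral_mem_Icc (hf.comp (hsec x)) fun y => hfm _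
    have hB := fun i => h.measurable_bregman hf (hu i)
    have hBK : ∀ i x, |bregman φ φ' (f x) (u i x)| ≤ K' :=
      fun i x => hK' _ (hfm x) _ (hum i x)
    rw [hint (fun x => φ (f x)) (h.measurable.comp hf) ⟨K, fun x => (hK _ (hfm x)).1⟩,
      hint f hf ⟨M, hfM⟩,
      Fin.sum_univ_succ]
    have hI1 : Integrable (fun x => ∫ y, φ (f (c (x, y))) ∂ν) (μ 0) :=
      hintx _ (h.measurable.comp hf) K fun x => (hK _ (hfm x)).1
    have hI2 : Integrable (fun x => φ (g x)) (μ 0) := h.integrable_comp hm hgmeas hgm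
    -- Entropy splits by conditioning on the first coordinate `x`. Here is the conditional part: the
    -- induction hypothesis for each frozen `x`.
    have step1 : ∫ x, ∫ y, φ (f (c (x, y))) ∂ν ∂(μ 0) - ∫ x, φ (g x) ∂(μ 0) ≤
        ∑ i : Fin n, ∫ x, bregman φ φ' (f x) (u i.succ x) ∂(Measure.pi μ) := by
      rw [← integral_sub hI1 hI2]
      have hsum : ∀ i : Fin n, Integrable
          (fun x => ∫ y, bregman φ φ' (f (c (x, y))) (u i.succ (c (x, y))) ∂ν) (μ 0) :=
        fun i => hintx _ (hB i.succ) K' (hBK i.succ)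
      rw [Finset.sum_congr rfl fun i _ => hint _ (hB (Fin.succ i)) ⟨K', hBK (Fin.succ i)⟩,
        ← integral_finsetSum _ fun i _ => hsum i]
      refine integral_mono (hI1.sub hI2) (integrable_finsetSum _ fun i _ => hsum i) fun x => ?_
      refine ih (fun j => μ j.succ) (fun y => f (c (x, y))) (fun i y => u i.succ (c (x, y)))
        (hf.comp (hsec x)) (fun i => (hu _).comp (hsec x)) (fun y => hfm _) (fun i y => hum _ _) ?_
      intro i y s
      change u i.succ (Fin.cons x (Function.update y i s)) = u i.succ (Fin.cons x y)
      rw [Fin.cons_update, hui]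
    have hu0 : ∀ x y, u 0 (c (x, y)) = u 0 (c (s₀, y)) := by
      intro x y
      change u 0 (Fin.cons x y) = u 0 (Fin.cons s₀ y)
      have := hui 0 (Fin.cons s₀ y) x
      rwa [Fin.update_cons_zero] at this
    -- The remaining entropy is that of `g`, the mean of `f` over the other coordinates. Since `u 0`
    -- ignores `x`, its mean is a constant to compare `g` with, and joint convexity moves the mean
    -- over `y` outside the divergence.
    have step2 : ∫ x, φ (g x) ∂(μ 0) - φ (∫ x, g x ∂(μ 0)) ≤
        ∫ x, bregman φ φ' (f x) (u 0 x) ∂(Measure.pi μ) := by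
      have hcm : ∫ y, u 0 (c (s₀, y)) ∂ν ∈ Set.Icc m M :=
        integral_mem_Icc ((hu 0).comp (hsec s₀)) fun y => hum 0 _
      refine (h.entropy_le_bregman_const hm hgmeas hgm hcm).trans ?_
      rw [hint _ (hB 0) ⟨K', hBK 0⟩]
      refine integral_mono
        (h.integrable_bregman hm hgmeas measurable_const hgm fun _ => hcm)
        (hintx _ (hB 0) K' (hBK 0)) fun x => ?_
      refine (h.bregman_integral_le hm (hf.comp (hsec x)) ((hu 0).comp (hsec s₀)) (fun y => hfm _)
        (fun y => hum 0 _)).trans_eq ?_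
      refine integral_congr_ae (.of_forall fun y => ?_)
      simp only [Function.comp_apply, hu0 x y]
    change ∫ x, ∫ y, φ (f (c (x, y))) ∂ν ∂(μ 0) - φ (∫ x, g x ∂(μ 0)) ≤ _
    linarith

end HasConvexBregman

/-! ### The entropies `x log x` and `x ^ p`, `1 ≤ p ≤ 2`. -/

/-- The divergence `a log (a/b) - a + b` is homogeneous of degree one, so its supporting planes pass
through the origin; they come from `log z ≤ z - 1` at `z = bA/(aB)`. -/
theorem hasConvexBregman_mul_log :
    HasConvexBregman (fun x => x * Real.log x) (fun x => Real.log x + 1) := by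
  have key : ∀ a b A B : ℝ, 0 < a → 0 < b → 0 < A → 0 < B →
      a - b * (A / B) ≤ a * (Real.log a - Real.log b - Real.log A + Real.log B) := by
    intro a b A B ha hb hA hB
    have h1 : Real.log (b * A / (a * B)) = Real.log b + Real.log A - Real.log a - Real.log B := by
      rw [Real.log_div (by positivity) (by positivity), Real.log_mul hb.ne' hA.ne',
        Real.log_mul ha.ne' hB.ne']
      ring
    have h2 := Real.log_le_sub_one_of_pos (show 0 < b * A / (a * B) by positivity)
    rw [h1] at h2
    have h3 := mul_le_mul_of_nonneg_left h2 ha.le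
    have h4 : a * (b * A / (a * B) - 1) = b * (A / B) - a := by field_simp
    linarith
  refine ⟨by fun_prop, by fun_prop, fun m M hm => ?_, fun a b ha hb => ?_, fun A B hA hB => ?_⟩
  · have hc : ContinuousOn Real.log (Set.Icc m M) :=
      Real.continuousOn_log.mono fun x hx => (hm.trans_le hx.1).ne'
    obtain ⟨K₁, h₁⟩ := isCompact_Icc.exists_bound_of_continuousOn (continuousOn_id.mul hc)
    obtain ⟨K₂, h₂⟩ := isCompact_Icc.exists_bound_of_continuousOn
      (hc.add (continuousOn_const (c := (1 : ℝ))))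
    exact ⟨max K₁ K₂, fun x hx =>
      ⟨(h₁ x hx).trans (le_max_left _ _), (h₂ x hx).trans (le_max_right _ _)⟩⟩
  · have := key a b 1 1 ha hb one_pos one_pos
    simp only [Real.log_one, div_one, mul_one] at this
    unfold bregman
    linarith
  · refine ⟨Real.log A - Real.log B, 1 - A / B, fun a b ha hb => ?_⟩
    have := key a b A B ha hb hA hB
    have e : A / B * B = A := by field_simp
    unfold bregman
    linarith

theorem bregman_mul_log_exp (x y : ℝ) :
    bregman (fun x => x * Real.log x) (fun x => Real.log x + 1) (Real.exp x) (Real.exp y) =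
      Real.exp x * (Real.exp (-(x - y)) + (x - y) - 1) := by
  have : Real.exp x * Real.exp (-(x - y)) = Real.exp y := by rw [← Real.exp_add]; ring_nf
  simp only [bregman, Real.log_exp]
  linear_combination -this

/-- A function on `[0, 1]` which vanishes to first order at `0` and is convex is nonnegative. -/
theorem nonneg_of_second_deriv_nonneg {W W' W'' : ℝ → ℝ}
    (h₁ : ∀ s ∈ Set.Icc (0 : ℝ) 1, HasDerivAt W (W' s) s)
    (h₂ : ∀ s ∈ Set.Icc (0 : ℝ) 1, HasDerivAt W' (W'' s) s)
    (h₃ : ∀ s ∈ Set.Icc (0 : ℝ) 1, 0 ≤ W'' s) (hW : W 0 = 0) (hW' : W' 0 = 0) : 0 ≤ W 1 := by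
  have mono : ∀ {V V' : ℝ → ℝ}, (∀ s ∈ Set.Icc (0 : ℝ) 1, HasDerivAt V (V' s) s) →
      (∀ s ∈ Set.Icc (0 : ℝ) 1, 0 ≤ V' s) → V 0 = 0 → ∀ s ∈ Set.Icc (0 : ℝ) 1, 0 ≤ V s := by
    intro V V' hd hn h0 s hs
    have : MonotoneOn V (Set.Icc 0 1) := by
      refine monotoneOn_of_deriv_nonneg (convex_Icc 0 1)
        (fun t ht => (hd t ht).continuousAt.continuousWithinAt)
        (fun t ht => (hd t (interior_subset ht)).differentiableAt.differentiableWithinAt)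
        fun t ht => ?_
      rw [(hd t (interior_subset ht)).deriv]
      exact hn t (interior_subset ht)
    rw [← h0]
    exact this (by simp) hs hs.1
  exact mono h₁ (mono h₂ h₃ hW') hW 1 (by simp)

/-- This is the gap between `(x, h) ↦ x ^ (p-2) * h ^ 2` and its tangent plane at `(X, H)`. The
function is `h ^ 2 / w` with `w = x ^ (2-p)`: a square controls the gap in `(w, h)`, and concavity
of `w` in `x` (Bernoulli) does the rest. -/
theorem rpow_two_sub_quadratic_nonneg {p x X : ℝ} (hp : 1 ≤ p) (hp2 : p ≤ 2) (hx : 0 < x)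
    (hX : 0 < X) (h H : ℝ) :
    0 ≤ x ^ (p - 2) * h ^ 2 - 2 * X ^ (p - 2) * H * h + X ^ (p - 2) * H ^ 2
      - (p - 2) * X ^ (p - 3) * H ^ 2 * (x - X) := by
  set w := x ^ (2 - p) with hw
  set V := X ^ (2 - p) with hV
  have hw0 : 0 < w := Real.rpow_pos_of_pos hx _
  have hV0 : 0 < V := Real.rpow_pos_of_pos hX _
  have e1 : x ^ (p - 2) = w⁻¹ := by rw [hw, ← Real.rpow_neg hx.le]; ring_nf
  have e2 : X ^ (p - 2) = V⁻¹ := by rw [hV, ← Real.rpow_neg hX.le]; ring_nf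
  have e3 : X ^ (p - 3) = V⁻¹ * X⁻¹ := by
    rw [← e2, ← Real.rpow_neg_one X, ← Real.rpow_add hX]; ring_nf
  have hb : w ≤ V * (1 + (2 - p) * (x / X - 1)) := by
    have h1 := rpow_one_add_le_one_add_mul_self (s := x / X - 1)
      (by have : 0 < x / X := by positivity
          linarith) (p := 2 - p) (by linarith) (by linarith)
    rw [add_sub_cancel, Real.div_rpow hx.le hX.le, div_le_iff₀ hV0] at h1
    linarith
  rw [e1, e2, e3]
  have h4 : 0 ≤ (h * V - H * w) ^ 2 / (w * V ^ 2) := by positivity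
  have h5 : H ^ 2 / V ^ 2 * w ≤ H ^ 2 / V ^ 2 * (V * (1 + (2 - p) * (x / X - 1))) :=
    mul_le_mul_of_nonneg_left hb (by positivity)
  have h6 : (h * V - H * w) ^ 2 / (w * V ^ 2)
      = w⁻¹ * h ^ 2 - 2 * V⁻¹ * H * h + H ^ 2 / V ^ 2 * w := by field_simp; ring
  have h7 : H ^ 2 / V ^ 2 * (V * (1 + (2 - p) * (x / X - 1)))
      = V⁻¹ * H ^ 2 - (p - 2) * (V⁻¹ * X⁻¹) * H ^ 2 * (x - X) := by field_simp; ring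
  linarith

theorem hasConvexBregman_rpow {p : ℝ} (hp : 1 ≤ p) (hp2 : p ≤ 2) :
    HasConvexBregman (fun x => x ^ p) (fun x => p * x ^ (p - 1)) := by
  refine ⟨by fun_prop, by fun_prop, fun m M hm => ?_, fun a b ha hb => ?_, fun A B hA hB => ?_⟩
  · have hc : ∀ r : ℝ, ContinuousOn (fun x : ℝ => x ^ r) (Set.Icc m M) := fun r =>
      continuousOn_id.rpow_const fun x hx => .inl (hm.trans_le hx.1).ne'
    obtain ⟨K₁, h₁⟩ := isCompact_Icc.exists_bound_of_continuousOn (hc p)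
    obtain ⟨K₂, h₂⟩ := isCompact_Icc.exists_bound_of_continuousOn
      ((continuousOn_const (c := p)).mul (hc (p - 1)))
    exact ⟨max K₁ K₂, fun x hx =>
      ⟨(h₁ x hx).trans (le_max_left _ _), (h₂ x hx).trans (le_max_right _ _)⟩⟩
  · have h1 := one_add_mul_self_le_rpow_one_add (s := a / b - 1)
      (by have : 0 < a / b := by positivity
          linarith) hp
    have hbp := Real.rpow_pos_of_pos hb p
    rw [add_sub_cancel, Real.div_rpow ha.le hb.le, le_div_iff₀ hbp] at h1
    have e : b ^ p = b ^ (p - 1) * b := by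
      rw [← Real.rpow_add_one hb.ne']; ring_nf
    have e2 : (1 + p * (a / b - 1)) * b ^ p = b ^ p + p * b ^ (p - 1) * (a - b) := by
      rw [e]; field_simp
    unfold bregman
    linarith
  -- The slopes are the partial derivatives of the divergence at `(A, B)`.
  · refine ⟨p * A ^ (p - 1) - p * B ^ (p - 1), -(p * (p - 1) * B ^ (p - 2) * (A - B)),
      fun a b ha hb => ?_⟩
    have hpos : ∀ {u v s : ℝ}, 0 < u → 0 < v → s ∈ Set.Icc (0 : ℝ) 1 → 0 < v + s * (u - v) := by
      intro u v s hu hv hs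
      have : v + s * (u - v) = (1 - s) * v + s * u := by ring
      rw [this]
      rcases hs.1.eq_or_lt with h | h
      · subst h; simpa
      · have := mul_nonneg (sub_nonneg.2 hs.2) hv.le
        positivity
    have hlin : ∀ u v s : ℝ, HasDerivAt (fun s => v + s * (u - v)) (u - v) s := fun u v s => by
      simpa using ((hasDerivAt_id s).mul_const (u - v)).const_add v
    have hd : ∀ (r : ℝ) {u v s : ℝ}, 0 < u → 0 < v → s ∈ Set.Icc (0 : ℝ) 1 →
        HasDerivAt (fun s => (v + s * (u - v)) ^ r)
          ((u - v) * r * (v + s * (u - v)) ^ (r - 1)) s := fun r u v s hu hv hs =>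
      (hlin u v s).rpow_const (.inl (hpos hu hv hs).ne')
    let x := fun s : ℝ => b + s * (a - b)
    let X := fun s : ℝ => B + s * (A - B)
    -- `W s` is the gap to be shown nonnegative, with `a` and `A` replaced by the points `x s` and
    -- `X s` of the segments from `b` and `B`. Its second derivative is `p (p-1)` times the
    -- preceding tangent-plane gap.
    have key := nonneg_of_second_deriv_nonneg
      (W := fun s => x s ^ p - b ^ p - p * b ^ (p - 1) * (s * (a - b))
        - (X s ^ p - B ^ p - p * B ^ (p - 1) * (s * (A - B)))
        - (p * X s ^ (p - 1) - p * B ^ (p - 1)) * (x s - X s)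
        + s * (p * (p - 1) * B ^ (p - 2) * (A - B) * (b - B)))
      (W' := fun s => (p * x s ^ (p - 1) - p * b ^ (p - 1)) * (a - b)
        - (p * X s ^ (p - 1) - p * B ^ (p - 1)) * (a - b)
        - p * (p - 1) * X s ^ (p - 2) * (A - B) * (x s - X s)
        + p * (p - 1) * B ^ (p - 2) * (A - B) * (b - B))
      (W'' := fun s => p * (p - 1) * (x s ^ (p - 2) * (a - b) ^ 2
        - 2 * X s ^ (p - 2) * (A - B) * (a - b) + X s ^ (p - 2) * (A - B) ^ 2
        - (p - 2) * X s ^ (p - 3) * (A - B) ^ 2 * (x s - X s))) ?_ ?_ ?_ ?_ ?_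
    · simp only [x, X, one_mul, add_sub_cancel] at key
      unfold bregman
      linarith
    · intro s hs
      have hl : ∀ k : ℝ, HasDerivAt (fun s : ℝ => s * k) k s := fun k => by
        simpa using (hasDerivAt_id s).mul_const k
      have := (((((hd p ha hb hs).sub_const (b ^ p)).sub
        ((hl (a - b)).const_mul (p * b ^ (p - 1)))).sub
        (((hd p hA hB hs).sub_const (B ^ p)).sub
        ((hl (A - B)).const_mul (p * B ^ (p - 1))))).sub
        ((((hd (p - 1) hA hB hs).const_mul p).sub_const (p * B ^ (p - 1))).mul
        ((hlin a b s).sub (hlin A B s)))).add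
        (hl (p * (p - 1) * B ^ (p - 2) * (A - B) * (b - B)))
      refine this.congr_deriv ?_
      have e : p - 1 - 1 = p - 2 := by ring
      simp only [x, X, e, Pi.sub_apply]
      ring
    · intro s hs
      have := (((((hd (p - 1) ha hb hs).const_mul p).sub_const (p * b ^ (p - 1))).mul_const
        (a - b)).sub ((((hd (p - 1) hA hB hs).const_mul p).sub_const
        (p * B ^ (p - 1))).mul_const (a - b))).sub
        ((((hd (p - 2) hA hB hs).const_mul (p * (p - 1))).mul_const (A - B)).mul
        ((hlin a b s).sub (hlin A B s)))
      refine (this.add_const (p * (p - 1) * B ^ (p - 2) * (A - B) * (b - B))).congr_deriv ?_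
      have e : p - 1 - 1 = p - 2 := by ring
      have e' : p - 2 - 1 = p - 3 := by ring
      simp only [x, X, e, e', Pi.sub_apply]
      ring
    · intro s hs
      exact mul_nonneg (mul_nonneg (by linarith) (by linarith))
        (rpow_two_sub_quadratic_nonneg hp hp2 (hpos ha hb hs) (hpos hA hB hs) _ _)
    · simp [x, X]
    · simp [x, X]

/-! ### Self-bounding functions: moment recursion and entropy of exponentials. -/

theorem HasConvexBregman.entropy_le_integral {φ φ' : ℝ → ℝ} (h : HasConvexBregman φ φ') {m M : ℝ}
    (hm : 0 < m) {S : Type*} [MeasurableSpace S] {n : ℕ} {μ : Fin n → Measure S}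
    [∀ i, IsProbabilityMeasure (μ i)] {f : (Fin n → S) → ℝ} {u : Fin n → (Fin n → S) → ℝ}
    (hf : Measurable f) (hu : ∀ i, Measurable (u i)) (hfm : ∀ x, f x ∈ Set.Icc m M)
    (hum : ∀ i x, u i x ∈ Set.Icc m M) (hui : ∀ i x s, u i (Function.update x i s) = u i x)
    {R : (Fin n → S) → ℝ} (hR : Integrable R (Measure.pi μ))
    (hle : ∀ᵐ x ∂(Measure.pi μ), ∑ i, bregman φ φ' (f x) (u i x) ≤ R x) :
    ∫ x, φ (f x) ∂(Measure.pi μ) - φ (∫ x, f x ∂(Measure.pi μ)) ≤ ∫ x, R x ∂(Measure.pi μ) := by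
  have hi := fun i => h.integrable_bregman (μ := Measure.pi μ) hm hf (hu i) hfm (hum i)
  refine (h.entropy_le_sum_bregman hm n μ f u hf hu hfm hum hui).trans ?_
  rw [← integral_finsetSum _ fun i _ => hi i]
  exact integral_mono_ae (integrable_finsetSum _ fun i _ => hi i) hR hle

/-- Bounded self-bounding functions on a product probability space. -/
structure IsSelfBounding {S : Type*} [MeasurableSpace S] {n : ℕ} (μ : Fin n → Measure S)
    (A m M : ℝ) (f : (Fin n → S) → ℝ) (u : Fin n → (Fin n → S) → ℝ) : Prop where
  measurable : Measurable f
  measurable_drop : ∀ i, Measurable (u i)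
  mem_Icc : ∀ x, f x ∈ Set.Icc m M
  drop_mem_Icc : ∀ i x, u i x ∈ Set.Icc m M
  drop_update : ∀ i x s, u i (Function.update x i s) = u i x
  sub_mem_Icc : ∀ᵐ x ∂(Measure.pi μ), ∀ i, f x - u i x ∈ Set.Icc 0 1
  sum_le : ∀ᵐ x ∂(Measure.pi μ), ∑ i, (f x - u i x) ≤ A * f x

/-- The left side is the Taylor remainder of `z ^ (N+2)` about `x`, evaluated at `y`; the second
derivative on `[y, x]` is largest at `x`. -/
theorem pow_bregman_le (N : ℕ) {x y : ℝ} (hy : 0 ≤ y) (hxy : y ≤ x) :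
    (N + 1) * x ^ (N + 2) + y ^ (N + 2) - (N + 2) * x ^ (N + 1) * y ≤
      (N + 1) * (N + 2) / 2 * (x - y) ^ 2 * x ^ N := by
  induction N with
  | zero => norm_num; nlinarith
  | succ N ih =>
    push_cast
    have h1 := mul_le_mul_of_nonneg_left ih hy
    have hx := hy.trans hxy
    have h2 : y * ((N + 1) * (N + 2) / 2 * (x - y) ^ 2 * x ^ N) ≤
        x * ((N + 1) * (N + 2) / 2 * (x - y) ^ 2 * x ^ N) :=
      mul_le_mul_of_nonneg_right hxy (by positivity)
    have h3 : (N + 1 + 1) * x ^ (N + 1 + 2) + y ^ (N + 1 + 2)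
        - (N + 1 + 2) * x ^ (N + 1 + 1) * y
        = y * ((N + 1) * x ^ (N + 2) + y ^ (N + 2) - (N + 2) * x ^ (N + 1) * y)
          + (N + 2) * x ^ (N + 1) * (x - y) ^ 2 := by ring
    rw [h3]
    calc _ ≤ x * ((N + 1) * (N + 2) / 2 * (x - y) ^ 2 * x ^ N)
          + (N + 2) * x ^ (N + 1) * (x - y) ^ 2 := by linarith
      _ = _ := by ring

theorem pow_succ_rpow_one_add_one_div (N : ℕ) {z : ℝ} (hz : 0 ≤ z) :
    (z ^ (N + 1)) ^ (1 + 1 / ((N : ℝ) + 1)) = z ^ (N + 2) := by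
  rw [← Real.rpow_natCast_mul hz, ← Real.rpow_natCast z (N + 2)]
  congr 1
  push_cast
  field_simp
  ring

/-- Duality of divergences: up to the factor `N + 1`, this is the divergence for `z ^ (N+2)` with
the roles of `x` and `y` exchanged. -/
theorem bregman_rpow_pow_le (N : ℕ) {x y : ℝ} (hy : 0 < y) (hxy : y ≤ x) :
    bregman (fun x : ℝ => x ^ (1 + 1 / ((N : ℝ) + 1)))
      (fun x => (1 + 1 / ((N : ℝ) + 1)) * x ^ (1 + 1 / ((N : ℝ) + 1) - 1))
      (x ^ (N + 1)) (y ^ (N + 1)) ≤ (N + 2) / 2 * (x - y) ^ 2 * x ^ N := by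
  have hN : (0 : ℝ) < (N : ℝ) + 1 := by positivity
  have e1 : ∀ z : ℝ, 0 < z → (z ^ (N + 1)) ^ (1 / ((N : ℝ) + 1)) = z := fun z hz => by
    rw [← Real.rpow_natCast_mul hz.le]
    push_cast
    rw [mul_one_div_cancel hN.ne', Real.rpow_one]
  have hx := hy.trans_le hxy
  simp only [bregman, pow_succ_rpow_one_add_one_div N hx.le,
    pow_succ_rpow_one_add_one_div N hy.le, add_sub_cancel_left, e1 y hy]
  have h := pow_bregman_le N hy.le hxy
  rw [← mul_le_mul_iff_right₀ hN]
  calc _ = (N + 1) * x ^ (N + 2) + y ^ (N + 2) - (N + 2) * x ^ (N + 1) * y := by field_simp; ring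
    _ ≤ _ := h
    _ = _ := by ring

theorem exp_neg_add_sub_one_le {t : ℝ} (ht : 0 ≤ t) :
    Real.exp (-t) + t - 1 ≤ t ^ 2 / 2 := by
  have h1 := Real.quadratic_le_exp_of_nonneg ht
  have h2 : Real.exp (-t) * Real.exp t = 1 := by rw [← Real.exp_add]; simp
  have h3 : Real.exp (-t) * (1 + t + t ^ 2 / 2) ≤ 1 := by
    simpa only [h2] using mul_le_mul_of_nonneg_left h1 (Real.exp_pos (-t)).le
  have h4 : 0 < 1 + t + t ^ 2 / 2 := by positivity
  -- The product equals `1 + t ^ 4 / 4`.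
  have h5 : 1 ≤ (1 - t + t ^ 2 / 2) * (1 + t + t ^ 2 / 2) := by nlinarith [pow_nonneg ht 4]
  have h6 := le_of_mul_le_mul_right (h3.trans h5) h4
  linarith

/-- The exponential lies below its chord between `0` and `s`. -/
theorem exp_mul_sub_sub_one_le {s d : ℝ} (hd : d ∈ Set.Icc (0 : ℝ) 1) :
    Real.exp (s * d) - s * d - 1 ≤ (Real.exp s - s - 1) * d := by
  have := convexOn_exp.2 (Set.mem_univ 0) (Set.mem_univ s) (sub_nonneg.2 hd.2) hd.1 (by ring)
  simp only [smul_eq_mul, mul_zero, zero_add, Real.exp_zero, mul_one] at this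
  rw [mul_comm d s] at this
  linarith

theorem exp_sub_sub_one_mul_one_sub_le {s : ℝ} (h0 : 0 ≤ s) (h1 : s ≤ 1) :
    (Real.exp s - s - 1) * (1 - s) ≤ s ^ 2 / 2 := by
  have h := Real.exp_bound' h0 h1 (n := 3) (by norm_num)
  norm_num [Finset.sum_range_succ, Nat.factorial] at h
  have h2 : Real.exp s - s - 1 ≤ s ^ 2 / 2 + s ^ 3 * (2 / 9) := by linarith
  have h3 := mul_le_mul_of_nonneg_right h2 (sub_nonneg.2 h1)
  have h4 : 0 ≤ s ^ 3 := by positivity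
  have h5 : 0 ≤ s ^ 3 * s := by positivity
  linarith [show (s ^ 2 / 2 + s ^ 3 * (2 / 9)) * (1 - s)
    = s ^ 2 / 2 - s ^ 3 * (5 / 18) - s ^ 3 * s * (2 / 9) by ring]

namespace IsSelfBounding

variable {S : Type*} [MeasurableSpace S] {n : ℕ} {μ : Fin n → Measure S}
  [∀ i, IsProbabilityMeasure (μ i)] {A m M : ℝ} {f : (Fin n → S) → ℝ}
  {u : Fin n → (Fin n → S) → ℝ}

theorem integrable_comp (h : IsSelfBounding μ A m M f u) {g : ℝ → ℝ} (hg : Continuous g) :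
    Integrable (fun x => g (f x)) (Measure.pi μ) := by
  obtain ⟨K, hK⟩ := isCompact_Icc.exists_bound_of_continuousOn (hg.continuousOn (s := Set.Icc m M))
  exact .of_bound (hg.measurable.comp h.measurable).aestronglyMeasurable K
    (.of_forall fun x => hK _ (h.mem_Icc x))

theorem integrable (h : IsSelfBounding μ A m M f u) : Integrable f (Measure.pi μ) :=
  h.integrable_comp continuous_id

/-- The divergence bound is quadratic in `f - u i`; since this difference lies in `[0, 1]`, its
square is at most itself, and the sum is then at most `A f`. -/
theorem integral_pow_succ_le (h : IsSelfBounding μ A m M f u) (hm : 0 < m) (N : ℕ) :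
    ∫ x, f x ^ (N + 2) ∂(Measure.pi μ) ≤
      (∫ x, f x ^ (N + 1) ∂(Measure.pi μ)) ^ (1 + 1 / ((N : ℝ) + 1)) +
        (N + 2) / 2 * A * ∫ x, f x ^ (N + 1) ∂(Measure.pi μ) := by
  have hN : (0 : ℝ) < (N : ℝ) + 1 := by positivity
  have hp : 0 ≤ 1 / ((N : ℝ) + 1) := by positivity
  have hp1 : 1 / ((N : ℝ) + 1) ≤ 1 := by rw [div_le_one hN]; linarith [N.cast_nonneg (α := ℝ)]
  have hpow : ∀ z ∈ Set.Icc m M, z ^ (N + 1) ∈ Set.Icc (m ^ (N + 1)) (M ^ (N + 1)) := fun z hz =>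
    ⟨pow_le_pow_left₀ hm.le hz.1 _, pow_le_pow_left₀ (hm.le.trans hz.1) hz.2 _⟩
  have key := (hasConvexBregman_rpow (p := 1 + 1 / ((N : ℝ) + 1)) (by linarith)
    (by linarith)).entropy_le_integral (pow_pos hm (N + 1)) (μ := μ)
    (f := fun x => f x ^ (N + 1)) (u := fun i x => u i x ^ (N + 1))
    (R := fun x => (N + 2) / 2 * A * f x ^ (N + 1))
    (h.measurable.pow_const _) (fun i => (h.measurable_drop i).pow_const _)
    (fun x => hpow _ (h.mem_Icc x)) (fun i x => hpow _ (h.drop_mem_Icc i x))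
    (fun i x s => by rw [h.drop_update])
    ((h.integrable_comp (continuous_pow (N + 1))).const_mul _) ?_
  · rw [integral_const_mul] at key
    simp only [fun x => pow_succ_rpow_one_add_one_div N (hm.le.trans (h.mem_Icc x).1)] at key
    linarith
  · filter_upwards [h.sub_mem_Icc, h.sum_le] with x h1 h2
    have hx := hm.le.trans (h.mem_Icc x).1
    calc _ ≤ ∑ i, (N + 2) / 2 * (f x - u i x) ^ 2 * f x ^ N := by
          refine Finset.sum_le_sum fun i _ => bregman_rpow_pow_le N
            (hm.trans_le (h.drop_mem_Icc i x).1) (by linarith [(h1 i).1])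
      _ ≤ ∑ i, (N + 2) / 2 * (f x - u i x) * f x ^ N := by
          refine Finset.sum_le_sum fun i _ => ?_
          gcongr
          nlinarith [(h1 i).1, (h1 i).2]
      _ = (N + 2) / 2 * f x ^ N * ∑ i, (f x - u i x) := by
          rw [Finset.mul_sum]; exact Finset.sum_congr rfl fun i _ => by ring
      _ ≤ (N + 2) / 2 * f x ^ N * (A * f x) := by gcongr
      _ = _ := by ring

theorem integral_pow_le (h : IsSelfBounding μ A m M f u) (hm : 0 < m) (hA : 0 ≤ A) (N : ℕ) :
    ∫ x, f x ^ (N + 1) ∂(Measure.pi μ) ≤ (∫ x, f x ∂(Measure.pi μ) + A * (N / 2)) ^ (N + 1) := by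
  have hE : 0 ≤ ∫ x, f x ∂(Measure.pi μ) := integral_nonneg fun x => hm.le.trans (h.mem_Icc x).1
  induction N with
  | zero => simp
  | succ N ih =>
    set b := ∫ x, f x ∂(Measure.pi μ) + A * (N / 2) with hb
    have hb0 : 0 ≤ b := by positivity
    set t := ∫ x, f x ^ (N + 1) ∂(Measure.pi μ) with ht
    have ht0 : 0 ≤ t := integral_nonneg fun x =>
      pow_nonneg (hm.le.trans (h.mem_Icc x).1) _
    have h1 : t ^ (1 + 1 / ((N : ℝ) + 1)) ≤ b ^ (N + 2) :=
      (Real.rpow_le_rpow ht0 ih (by positivity)).trans_eq (pow_succ_rpow_one_add_one_div N hb0)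
    have h2 : (N + 2) / 2 * A * t ≤ (N + 2) / 2 * A * b ^ (N + 1) := by gcongr
    -- Bernoulli's inequality for `(1 + A/(2b)) ^ (N+2)`: each step of the recursion costs `A/2`.
    have h3 : b ^ (N + 2) + (N + 2) / 2 * A * b ^ (N + 1) ≤ (b + A / 2) ^ (N + 2) := by
      rcases hb0.eq_or_lt with hb1 | hb1
      · rw [← hb1]; simp; positivity
      · have h4 := one_add_mul_le_pow (a := A / 2 / b)
          (by have : 0 ≤ A / 2 / b := by positivity
              linarith) (N + 2)
        have h5 := mul_le_mul_of_nonneg_right h4 (pow_nonneg hb0 (N + 2))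
        rw [← mul_pow] at h5
        have e1 : (1 + A / 2 / b) * b = b + A / 2 := by field_simp
        have e2 : (1 + ((N + 2 : ℕ) : ℝ) * (A / 2 / b)) * b ^ (N + 2)
            = b ^ (N + 2) + (N + 2) / 2 * A * b ^ (N + 1) := by
          rw [pow_succ b (N + 1)]; push_cast; field_simp
        rwa [e1, e2] at h5
    have e : ∫ x, f x ∂(Measure.pi μ) + A * ((N + 1 : ℕ) / 2) = b + A / 2 := by
      rw [hb]; push_cast; ring
    rw [e]
    linarith [h.integral_pow_succ_le hm N]

theorem hasDerivAt_mgf (h : IsSelfBounding μ A m M f u) (t : ℝ) :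
    HasDerivAt (mgf f (Measure.pi μ)) (∫ x, f x * Real.exp (t * f x) ∂(Measure.pi μ)) t := by
  refine ProbabilityTheory.hasDerivAt_mgf ?_
  have : integrableExpSet f (Measure.pi μ) = Set.univ := Set.eq_univ_of_forall fun t =>
    integrable_exp_mul_of_mem_Icc h.measurable.aemeasurable (.of_forall h.mem_Icc)
  simp [this]

theorem mgf_pos (h : IsSelfBounding μ A m M f u) (t : ℝ) : 0 < mgf f (Measure.pi μ) t :=
  ProbabilityTheory.mgf_pos
    (integrable_exp_mul_of_mem_Icc h.measurable.aemeasurable (.of_forall h.mem_Icc))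

/-- The slope `ψ` is left free so that both signs of `t` are covered: `t² / 2` serves for `t > 0`,
and `exp s - s - 1` for `t = -s < 0`. -/
theorem entropy_exp_le (h : IsSelfBounding μ A m M f u) (t : ℝ) {ψ : ℝ} (hψ0 : 0 ≤ ψ)
    (hψ : ∀ d ∈ Set.Icc (0 : ℝ) 1, Real.exp (-(t * d)) + t * d - 1 ≤ ψ * d) :
    (t - ψ * A) * ∫ x, f x * Real.exp (t * f x) ∂(Measure.pi μ) ≤
      mgf f (Measure.pi μ) t * Real.log (mgf f (Measure.pi μ) t) := by
  have hbd : ∀ z ∈ Set.Icc m M, Real.exp (t * z) ∈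
      Set.Icc (Real.exp (-(|t| * max |m| |M|))) (Real.exp (|t| * max |m| |M|)) := by
    intro z hz
    have h1 : |t * z| ≤ |t| * max |m| |M| := by
      rw [abs_mul]
      exact mul_le_mul_of_nonneg_left (abs_le_max_abs_abs hz.1 hz.2) (abs_nonneg _)
    exact ⟨Real.exp_le_exp.2 (abs_le.1 h1).1, Real.exp_le_exp.2 (abs_le.1 h1).2⟩
  have hi : Integrable (fun x => f x * Real.exp (t * f x)) (Measure.pi μ) :=
    h.integrable_comp (g := fun z => z * Real.exp (t * z)) (by fun_prop)
  have key := hasConvexBregman_mul_log.entropy_le_integral (Real.exp_pos _) (μ := μ)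
    (f := fun x => Real.exp (t * f x)) (u := fun i x => Real.exp (t * u i x))
    (R := fun x => ψ * A * (f x * Real.exp (t * f x)))
    (h.measurable.const_mul t).exp (fun i => ((h.measurable_drop i).const_mul t).exp)
    (fun x => hbd _ (h.mem_Icc x)) (fun i x => hbd _ (h.drop_mem_Icc i x))
    (fun i x s => by rw [h.drop_update]) (hi.const_mul _) ?_
  · simp only [Real.log_exp] at key
    have e : ∫ x, Real.exp (t * f x) * (t * f x) ∂(Measure.pi μ)
        = t * ∫ x, f x * Real.exp (t * f x) ∂(Measure.pi μ) := by
      rw [← integral_const_mul]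
      exact integral_congr_ae (.of_forall fun x => by ring)
    rw [e, integral_const_mul] at key
    change _ - mgf f (Measure.pi μ) t * Real.log (mgf f (Measure.pi μ) t) ≤ _ at key
    linarith
  · filter_upwards [h.sub_mem_Icc, h.sum_le] with x h1 h2
    simp only [bregman_mul_log_exp]
    calc _ ≤ ∑ i, Real.exp (t * f x) * (ψ * (f x - u i x)) := by
          refine Finset.sum_le_sum fun i _ => mul_le_mul_of_nonneg_left ?_ (Real.exp_pos _).le
          have := hψ _ (h1 i)
          rwa [mul_sub] at this
      _ = Real.exp (t * f x) * ψ * ∑ i, (f x - u i x) := by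
          rw [Finset.mul_sum]; exact Finset.sum_congr rfl fun i _ => by ring
      _ ≤ Real.exp (t * f x) * ψ * (A * f x) := by gcongr
      _ = _ := by ring

end IsSelfBounding

/-! ### Herbst's argument and the Laplace transform bounds. -/

open scoped Topology

/-- Integration of the differential inequality `t (G ρ)' ≤ G ρ`. -/
theorem mul_le_of_deriv_mul_le {G G' ρ ρ' : ℝ → ℝ} {T : ℝ} (hG : ∀ t, HasDerivAt G (G' t) t)
    (hG0 : G 0 = 0) (hρ : ∀ t, 0 < t → t < T → HasDerivAt ρ (ρ' t) t) (hρc : ContinuousAt ρ 0)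
    (hρ0 : ρ 0 = 1)
    (hle : ∀ t, 0 < t → t < T → t * (G' t * ρ t + G t * ρ' t) ≤ G t * ρ t) {t : ℝ} (ht : 0 < t)
    (htT : t < T) : G t * ρ t ≤ G' 0 * t := by
  have hd : ∀ x ∈ Set.Ioo 0 T, HasDerivAt (fun x => G x * ρ x / x)
      (((G' x * ρ x + G x * ρ' x) * x - G x * ρ x * 1) / x ^ 2) x := fun x hx =>
    ((hG x).mul (hρ x hx.1 hx.2)).div (hasDerivAt_id x) hx.1.ne'
  -- The hypothesis says that `G ρ / x` is nonincreasing; its limit at `0` from the right is `G' 0`.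
  have hanti : AntitoneOn (fun x => G x * ρ x / x) (Set.Ioo 0 T) := by
    refine antitoneOn_of_deriv_nonpos (convex_Ioo 0 T)
      (fun x hx => (hd x hx).continuousAt.continuousWithinAt)
      (fun x hx => (hd x (interior_subset hx)).differentiableAt.differentiableWithinAt)
      fun x hx => ?_
    have hx' := interior_subset hx
    rw [(hd x hx').deriv]
    refine div_nonpos_of_nonpos_of_nonneg ?_ (sq_nonneg x)
    linarith [hle x hx'.1 hx'.2]
  have hlim : Filter.Tendsto (fun x => G x * ρ x / x) (𝓝[>] 0) (𝓝 (G' 0)) := by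
    have h1 : Filter.Tendsto (fun x => x⁻¹ • (G (0 + x) - G 0)) (𝓝[>] 0) (𝓝 (G' 0)) :=
      ((hasDerivAt_iff_tendsto_slope_zero.1 (hG 0)).mono_left
        (nhdsWithin_mono _ fun x hx => (Set.mem_Ioi.1 hx).ne'))
    have h2 : Filter.Tendsto ρ (𝓝[>] 0) (𝓝 1) := by
      rw [← hρ0]; exact hρc.tendsto.mono_left nhdsWithin_le_nhds
    have h3 := h1.mul h2
    rw [mul_one] at h3
    refine h3.congr fun x => ?_
    simp only [zero_add, hG0, sub_zero, smul_eq_mul]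
    ring
  have hev : ∀ᶠ x in 𝓝[>] (0 : ℝ), G t * ρ t / t ≤ G x * ρ x / x := by
    filter_upwards [Ioo_mem_nhdsGT ht] with x hx
    exact hanti ⟨hx.1, hx.2.trans htT⟩ ⟨ht, htT⟩ hx.2.le
  exact (div_le_iff₀ ht).1 (ge_of_tendsto hlim hev)

namespace IsSelfBounding

variable {S : Type*} [MeasurableSpace S] {n : ℕ} {μ : Fin n → Measure S}
  [∀ i, IsProbabilityMeasure (μ i)] {A m M : ℝ} {f : (Fin n → S) → ℝ}
  {u : Fin n → (Fin n → S) → ℝ}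

theorem hasDerivAt_log_mgf (h : IsSelfBounding μ A m M f u) (t : ℝ) :
    HasDerivAt (fun t => Real.log (mgf f (Measure.pi μ) t))
      ((∫ x, f x * Real.exp (t * f x) ∂(Measure.pi μ)) / mgf f (Measure.pi μ) t) t :=
  (h.hasDerivAt_mgf t).log (h.mgf_pos t).ne'

theorem entropy_exp_le_div (h : IsSelfBounding μ A m M f u) (t : ℝ) {ψ : ℝ} (hψ0 : 0 ≤ ψ)
    (hψ : ∀ d ∈ Set.Icc (0 : ℝ) 1, Real.exp (-(t * d)) + t * d - 1 ≤ ψ * d) :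
    (t - ψ * A) * ((∫ x, f x * Real.exp (t * f x) ∂(Measure.pi μ)) / mgf f (Measure.pi μ) t) ≤
      Real.log (mgf f (Measure.pi μ) t) := by
  rw [← mul_div_assoc, div_le_iff₀ (h.mgf_pos t), mul_comm (Real.log _)]
  exact h.entropy_exp_le t hψ0 hψ

/-- Sub-gamma upper tail of self-bounding functions. -/
theorem log_mgf_le (h : IsSelfBounding μ A m M f u) {t : ℝ} (ht : 0 < t) (htA : A / 2 * t < 1)
    (hA : 0 < A) :
    Real.log (mgf f (Measure.pi μ) t) * (1 - A / 2 * t) ≤ (∫ x, f x ∂(Measure.pi μ)) * t := by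
  -- This `ρ` is the integrating factor of `t (1 - A t / 2) G' ≤ G`.
  have key := mul_le_of_deriv_mul_le (T := 2 / A) (ρ := fun t => 1 - A / 2 * t)
    (ρ' := fun _ => -(A / 2)) h.hasDerivAt_log_mgf (by simp)
    (fun t _ _ => by simpa using ((hasDerivAt_id t).const_mul (A / 2)).const_sub 1)
    (by fun_prop) (by simp) ?_ ht ?_
  · simpa using key
  · intro t ht _
    have := h.entropy_exp_le_div t (ψ := t ^ 2 / 2) (by positivity) fun d hd => by
      have h1 := exp_neg_add_sub_one_le (mul_nonneg ht.le hd.1)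
      have h2 : d ^ 2 ≤ d := by nlinarith [hd.1, hd.2]
      have h3 := mul_le_mul_of_nonneg_left h2 (show 0 ≤ t ^ 2 / 2 by positivity)
      linarith [show (t * d) ^ 2 / 2 = t ^ 2 / 2 * d ^ 2 by ring]
    linarith
  · rw [lt_div_iff₀ hA]; linarith

/-- Sub-Gaussian lower tail of self-bounding functions. -/
theorem log_mgf_neg_le (h : IsSelfBounding μ A m M f u) (hm : 0 ≤ m) (hA : 1 ≤ A) {s : ℝ}
    (hs : 0 < s) :
    Real.log (mgf f (Measure.pi μ) (-s)) ≤
      -(∫ x, f x ∂(Measure.pi μ)) * (s * (1 - A / 2 * s)) := by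
  have hA0 : 0 < A := by linarith
  have hlog : ∀ s, 0 ≤ s → Real.log (mgf f (Measure.pi μ) (-s)) ≤ 0 := by
    intro s hs
    refine Real.log_nonpos (h.mgf_pos _).le ?_
    have := integral_mono (μ := Measure.pi μ) (g := fun _ => (1 : ℝ))
      (h.integrable_comp (g := fun z => Real.exp (-s * z)) (by fun_prop)) (integrable_const _)
      fun x => Real.exp_le_one_iff.2 <| by
        have := mul_nonneg hs (hm.trans (h.mem_Icc x).1)
        linarith
    simpa [mgf] using this
  by_cases hsA : A / 2 * s < 1
  · set G' : ℝ → ℝ := fun s => -((∫ x, f x * Real.exp (-s * f x) ∂(Measure.pi μ)) /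
      mgf f (Measure.pi μ) (-s)) with hG'
    have hG'0 : ∀ s, G' s ≤ 0 := fun s => neg_nonpos.2 <| div_nonneg
      (integral_nonneg fun x => mul_nonneg (hm.trans (h.mem_Icc x).1) (Real.exp_pos _).le)
      (h.mgf_pos _).le
    have key := mul_le_of_deriv_mul_le (T := 2 / A)
      (G := fun s => Real.log (mgf f (Measure.pi μ) (-s))) (G' := G')
      (ρ := fun t => (1 - A / 2 * t)⁻¹) (ρ' := fun t => A / 2 / (1 - A / 2 * t) ^ 2)
      (fun t => by
        have := (h.hasDerivAt_log_mgf (-t)).scomp t (hasDerivAt_neg t)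
        simpa [hG', Function.comp_def] using this) (by simp)
      (fun t _ ht => by
        have : 1 - A / 2 * t ≠ 0 := by
          rw [lt_div_iff₀ hA0] at ht
          linarith
        simpa using (((hasDerivAt_id t).const_mul (A / 2)).const_sub 1).fun_inv this)
      (by
        refine ContinuousAt.inv₀ (by fun_prop) (by simp)) (by simp) ?_ hs
      (by rw [lt_div_iff₀ hA0]; linarith)
    · have hpos : 0 < 1 - A / 2 * s := by linarith
      rw [← div_eq_mul_inv, div_le_iff₀ hpos] at key
      refine key.trans_eq ?_
      simp [hG']
      ring
    · intro t ht htA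
      rw [lt_div_iff₀ hA0] at htA
      have hpos : 0 < 1 - A / 2 * t := by linarith
      set g := Real.log (mgf f (Measure.pi μ) (-t)) with hg
      have hg0 : g ≤ 0 := hlog t ht.le
      set ψ := Real.exp t - t - 1 with hψ
      have hψ0 : 0 ≤ ψ := by linarith [Real.add_one_le_exp t]
      have hent : (t + ψ * A) * G' t ≤ g := by
        have := h.entropy_exp_le_div (-t) hψ0 fun d hd => by
          have := exp_mul_sub_sub_one_le (s := t) hd
          rw [neg_mul, neg_neg]
          linarith
        rw [hG']
        linarith
      -- This is the condition on the integrating factor `(1 - A t / 2)⁻¹`. If `A t ≤ 1`, it follows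
      -- from `hent` multiplied by `1 - A t`, since `G' ≤ 0`; `A ≥ 1` ensures `t ≤ 1`. If `A t ≥ 1`,
      -- the two sides have opposite signs.
      have hmain : t * (1 - A / 2 * t) * G' t ≤ g * (1 - A * t) := by
        rcases le_total (A * t) 1 with hAt | hAt
        · have ht1 : t ≤ 1 := by nlinarith
          have h1 := exp_sub_sub_one_mul_one_sub_le ht.le ht1
          have h2 : ψ * (1 - A * t) ≤ ψ * (1 - t) :=
            mul_le_mul_of_nonneg_left (by nlinarith) hψ0
          have h3 : A * (ψ * (1 - A * t)) ≤ A * (t ^ 2 / 2) :=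
            mul_le_mul_of_nonneg_left (h2.trans h1) hA0.le
          have h4 : (1 - A * t) * (t + ψ * A) ≤ t * (1 - A / 2 * t) := by linarith
          have h5 := mul_le_mul_of_nonpos_right h4 (hG'0 t)
          have h6 := mul_le_mul_of_nonneg_left hent (sub_nonneg.2 hAt)
          linarith
        · have h1 : 0 ≤ g * (1 - A * t) := mul_nonneg_of_nonpos_of_nonpos hg0 (by linarith)
          have h2 := mul_nonpos_of_nonneg_of_nonpos (mul_nonneg ht.le hpos.le) (hG'0 t)
          linarith
      have e1 : t * (G' t * (1 - A / 2 * t)⁻¹ + g * (A / 2 / (1 - A / 2 * t) ^ 2))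
          = (t * (1 - A / 2 * t) * G' t + g * (A / 2 * t)) / (1 - A / 2 * t) ^ 2 := by
        field_simp
      have e2 : g * (1 - A / 2 * t)⁻¹ = g * (1 - A / 2 * t) / (1 - A / 2 * t) ^ 2 := by
        field_simp
      rw [e1, e2]
      gcongr
      linarith
  -- Once `A s / 2 ≥ 1`, the claimed bound is nonnegative while the logarithm is not positive.
  · have h1 := hlog s hs.le
    have h2 : 0 ≤ ∫ x, f x ∂(Measure.pi μ) := integral_nonneg fun x => hm.trans (h.mem_Icc x).1
    have h3 : s * (1 - A / 2 * s) ≤ 0 :=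
      mul_nonpos_of_nonneg_of_nonpos hs.le (by linarith)
    have h4 := mul_nonneg_of_nonpos_of_nonpos (neg_nonpos.2 h2) h3
    linarith

end IsSelfBounding

/-! ### From Laplace transforms to moments. -/

theorem eLpNorm_le_of_integral_rpow_le {α : Type*} [MeasurableSpace α] {P : Measure α}
    [IsProbabilityMeasure P] {g : α → ℝ} {K b q : ℝ} (hg : Measurable g)
    (hgK : ∀ x, g x ∈ Set.Icc 0 K) (hq : 0 < q) (hb : 0 ≤ b) (h : ∫ x, g x ^ q ∂P ≤ b ^ q) :
    eLpNorm g (ENNReal.ofReal q) P ≤ ENNReal.ofReal b := by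
  have hmem : MemLp g (ENNReal.ofReal q) P := .of_bound hg.aestronglyMeasurable K
    (.of_forall fun x => by rw [Real.norm_of_nonneg (hgK x).1]; exact (hgK x).2)
  rw [hmem.eLpNorm_eq_integral_rpow_norm (by simpa using hq) ENNReal.ofReal_ne_top,
    ENNReal.toReal_ofReal hq.le]
  refine ENNReal.ofReal_le_ofReal ?_
  simp only [fun x => Real.norm_of_nonneg (hgK x).1]
  rw [Real.rpow_inv_le_iff_of_pos (integral_nonneg fun x => Real.rpow_nonneg (hgK x).1 q) hb hq]
  exact h

/-- A moment bound for the positive part of `Y` from a bound for its Laplace transform. -/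
theorem eLpNorm_posPart_le_of_integral_exp_le {α : Type*} [MeasurableSpace α] {P : Measure α}
    [IsProbabilityMeasure P] {Y : α → ℝ} {K q t : ℝ} (hY : Measurable Y) (hYK : ∀ x, |Y x| ≤ K)
    (hq : 0 < q) (ht : 0 < t) (h : ∫ x, Real.exp (t * Y x) ∂P ≤ Real.exp (q / 2)) :
    eLpNorm (fun x => max (Y x) 0) (ENNReal.ofReal q) P ≤ ENNReal.ofReal (2 / 3 * (q / t)) := by
  have hexp : Real.exp (-(1 / 2)) ≤ 2 / 3 := by
    have h1 := Real.add_one_le_exp (1 / 2 : ℝ)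
    have h2 : Real.exp (-(1 / 2)) * Real.exp (1 / 2) = 1 := by rw [← Real.exp_add]; simp
    nlinarith [Real.exp_pos (-(1 / 2))]
  have hqt : 0 < q / t := by positivity
  -- From `z ≤ exp (z - 1)` at `z = t Y / q`, raised to the power `q`. After integration the
  -- constant is `exp (-1/2) ≤ 2/3`.
  have hpt : ∀ x, max (Y x) 0 ^ q ≤ (q / t) ^ q * Real.exp (-q) * Real.exp (t * Y x) := by
    intro x
    have h1 : max (Y x) 0 ≤ q / t * Real.exp (t * Y x / q - 1) := by
      refine max_le ?_ (by positivity)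
      have h2 := mul_le_mul_of_nonneg_left (Real.add_one_le_exp (t * Y x / q - 1)) hqt.le
      have h3 : q / t * (t * Y x / q - 1 + 1) = Y x := by field_simp; ring
      rwa [h3] at h2
    refine (Real.rpow_le_rpow (le_max_right _ _) h1 hq.le).trans_eq ?_
    rw [Real.mul_rpow hqt.le (Real.exp_pos _).le, ← Real.exp_mul, mul_assoc, ← Real.exp_add]
    congr 2
    field_simp
    ring
  have hK : 0 ≤ K := by
    have : Nonempty α := P.nonempty_of_neZero
    exact (abs_nonneg _).trans (hYK (Classical.arbitrary α))
  have hg : Measurable fun x => max (Y x) 0 := hY.max measurable_const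
  have hgK : ∀ x, max (Y x) 0 ∈ Set.Icc 0 K := fun x =>
    ⟨le_max_right _ _, max_le ((le_abs_self _).trans (hYK x)) hK⟩
  have hi : Integrable (fun x => Real.exp (t * Y x)) P :=
    integrable_exp_mul_of_mem_Icc (a := -K) (b := K) hY.aemeasurable
      (.of_forall fun x => abs_le.1 (hYK x))
  refine eLpNorm_le_of_integral_rpow_le hg hgK hq (by positivity) ?_
  calc ∫ x, max (Y x) 0 ^ q ∂P
      ≤ ∫ x, (q / t) ^ q * Real.exp (-q) * Real.exp (t * Y x) ∂P :=
        integral_mono_of_nonneg (.of_forall fun x => Real.rpow_nonneg (le_max_right _ _) q)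
          (hi.const_mul _) (.of_forall hpt)
    _ = (q / t) ^ q * Real.exp (-q) * ∫ x, Real.exp (t * Y x) ∂P := integral_const_mul _ _
    _ ≤ (q / t) ^ q * Real.exp (-q) * Real.exp (q / 2) := by gcongr
    _ = (Real.exp (-(1 / 2)) * (q / t)) ^ q := by
        rw [Real.mul_rpow (Real.exp_pos _).le hqt.le, ← Real.exp_mul, mul_assoc, ← Real.exp_add,
          mul_comm]
        congr 2
        ring
    _ ≤ (2 / 3 * (q / t)) ^ q := by gcongr

theorem one_le_sqrt_kappa : 1 ≤ Real.sqrt kappa := by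
  rw [Real.one_le_sqrt]
  unfold kappa
  have h1 : 1 < Real.sqrt (Real.exp 1) := Real.lt_sqrt_of_sq_lt (by
    have := Real.add_one_le_exp (1 : ℝ)
    linarith)
  have h2 : Real.sqrt (Real.exp 1) ≤ 2 := Real.sqrt_le_iff.2 ⟨by norm_num, by
    linarith [Real.exp_one_lt_d9]⟩
  rw [one_le_div (by linarith)]
  linarith

namespace IsSelfBounding

variable {S : Type*} [MeasurableSpace S] {n : ℕ} {μ : Fin n → Measure S} {A m M : ℝ}
  {f : (Fin n → S) → ℝ} {u : Fin n → (Fin n → S) → ℝ}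

/-- A shift makes the values strictly positive, as the powers `x ^ p` are treated on `(0, ∞)` only;
`ε` tends to `0` in `eLpNorm_le`. -/
theorem add_const (h : IsSelfBounding μ A m M f u) (hA : 0 ≤ A) {ε : ℝ} (hε : 0 ≤ ε) :
    IsSelfBounding μ A (m + ε) (M + ε) (fun x => f x + ε) (fun i x => u i x + ε) where
  measurable := h.measurable.add_const ε
  measurable_drop i := (h.measurable_drop i).add_const ε
  mem_Icc x := ⟨by linarith [(h.mem_Icc x).1], by linarith [(h.mem_Icc x).2]⟩
  drop_mem_Icc i x := ⟨by linarith [(h.drop_mem_Icc i x).1], by linarith [(h.drop_mem_Icc i x).2]⟩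
  drop_update i x s := by rw [h.drop_update]
  sub_mem_Icc := by simpa only [add_sub_add_right_eq_sub] using h.sub_mem_Icc
  sum_le := by
    filter_upwards [h.sum_le] with x hx
    simp only [add_sub_add_right_eq_sub]
    nlinarith [mul_nonneg hA hε]

variable [∀ i, IsProbabilityMeasure (μ i)]

theorem abs_sub_integral_le (h : IsSelfBounding μ A m M f u) (x : Fin n → S) :
    |f x - ∫ y, f y ∂(Measure.pi μ)| ≤ M - m := by
  have h1 := h.mem_Icc x
  have h2 := integral_mem_Icc (μ := Measure.pi μ) h.measurable h.mem_Icc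
  exact abs_sub_le_iff.2 ⟨by linarith [h1.2, h2.1], by linarith [h1.1, h2.2]⟩

theorem eLpNorm_le (h : IsSelfBounding μ A 0 M f u) (hA : 0 ≤ A) {q : ℕ} (hq : 1 ≤ q) :
    eLpNorm f q (Measure.pi μ) ≤
      ENNReal.ofReal (∫ x, f x ∂(Measure.pi μ) + A * (((q : ℝ) - 1) / 2)) := by
  obtain ⟨N, rfl⟩ : ∃ N, q = N + 1 := ⟨q - 1, by omega⟩
  set E := ∫ x, f x ∂(Measure.pi μ) with hE
  have hE0 : 0 ≤ E := integral_nonneg fun x => (h.mem_Icc x).1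
  have e : (((N + 1 : ℕ) : ℝ) - 1) / 2 = N / 2 := by push_cast; ring
  rw [e, ← ENNReal.ofReal_natCast]
  refine eLpNorm_le_of_integral_rpow_le h.measurable h.mem_Icc (by positivity) (by positivity) ?_
  simp only [Real.rpow_natCast]
  have hlim : Filter.Tendsto (fun ε : ℝ => (E + ε + A * (N / 2)) ^ (N + 1)) (𝓝[>] 0)
      (𝓝 ((E + A * (N / 2)) ^ (N + 1))) := by
    have : ContinuousAt (fun ε : ℝ => (E + ε + A * (N / 2)) ^ (N + 1)) 0 := by fun_prop
    have := this.tendsto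
    rw [add_zero] at this
    exact this.mono_left nhdsWithin_le_nhds
  refine ge_of_tendsto hlim ?_
  filter_upwards [self_mem_nhdsWithin] with ε hε
  have hε : 0 < ε := hε
  have h' := h.add_const hA hε.le
  have key := h'.integral_pow_le (by linarith) hA N
  rw [integral_add h.integrable (integrable_const ε)] at key
  simp only [integral_const, probReal_univ, smul_eq_mul, one_mul] at key
  refine le_trans ?_ key
  refine integral_mono (h.integrable_comp (continuous_pow (N + 1)))
    (h'.integrable_comp (continuous_pow (N + 1))) fun x => ?_
  exact pow_le_pow_left₀ (h.mem_Icc x).1 (by linarith) _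

theorem eLpNorm_posPart_le (h : IsSelfBounding μ A 0 M f u) (hA : 0 < A) {q : ℝ} (hq : 0 < q) :
    eLpNorm (fun x => max (f x - ∫ y, f y ∂(Measure.pi μ)) 0) (ENNReal.ofReal q) (Measure.pi μ) ≤
      ENNReal.ofReal (Real.sqrt (A * q * ∫ x, f x ∂(Measure.pi μ)) + A * q / 2) := by
  set E := ∫ x, f x ∂(Measure.pi μ) with hE
  have hE0 : 0 ≤ E := integral_nonneg fun x => (h.mem_Icc x).1
  set r := Real.sqrt (A * q * E) with hr
  have hr0 : 0 ≤ r := Real.sqrt_nonneg _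
  have hr2 : r ^ 2 = A * q * E := Real.sq_sqrt (by positivity)
  -- With `t = 1/(A/2 + s)` one gets `q/t = r + 3Aq/4`, so the factor `2/3` leaves exactly `A q / 2`
  -- and at most `r`. The term `r/q` alone gives `A E ≤ q s²`, which bounds the centred log-Laplace
  -- transform by `q/2`.
  set s := r / q + A / 4 with hs
  have hs0 : 0 < s := by positivity
  have hs2 : A * E ≤ q * s ^ 2 := by
    have h1 : (r / q) ^ 2 ≤ s ^ 2 := by
      gcongr
      linarith
    have h2 : q * (r / q) ^ 2 = A * E := by rw [div_pow, hr2]; field_simp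
    rw [← h2]
    gcongr
  set t := 1 / (A / 2 + s) with ht
  have ht0 : 0 < t := by positivity
  have e1 : 1 - A / 2 * t = s * t := by rw [ht]; field_simp; ring
  have hlog := h.log_mgf_le ht0 (by nlinarith [mul_pos hs0 ht0]) hA
  rw [e1] at hlog
  have hlog2 : Real.log (mgf f (Measure.pi μ) t) - t * E ≤ q / 2 := by
    have h1 : Real.log (mgf f (Measure.pi μ) t) * s ≤ E := by
      refine le_of_mul_le_mul_right ?_ ht0
      linarith
    have h2 : t * (A / 2 + s) = 1 := by rw [ht]; field_simp
    have h3 : (Real.log (mgf f (Measure.pi μ) t) - t * E) * s ≤ E * t * (A / 2) := by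
      nlinarith
    have h4 : E * t * (A / 2) ≤ q / 2 * s := by
      have h5 : t * s ≤ 1 := by nlinarith
      have h6 : t * (A * E) ≤ t * (q * s ^ 2) := by gcongr
      have h7 : (t * s) * (q * s) ≤ 1 * (q * s) := by gcongr
      linarith
    exact le_of_mul_le_mul_right (h3.trans h4) hs0
  have hexp : ∫ x, Real.exp (t * (f x - E)) ∂(Measure.pi μ) ≤ Real.exp (q / 2) := by
    have e : ∀ x, Real.exp (t * (f x - E)) = Real.exp (-(t * E)) * Real.exp (t * f x) := fun x => by
      rw [← Real.exp_add]; ring_nf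
    simp only [e]
    rw [integral_const_mul]
    change _ * mgf f (Measure.pi μ) t ≤ _
    rw [← Real.exp_log (h.mgf_pos t), ← Real.exp_add, Real.exp_le_exp]
    linarith
  refine (eLpNorm_posPart_le_of_integral_exp_le (h.measurable.sub_const E)
    h.abs_sub_integral_le hq ht0 hexp).trans (ENNReal.ofReal_le_ofReal ?_)
  have e2 : 2 / 3 * (q / t) = A * q / 2 + 2 / 3 * r := by
    rw [ht, hs]; field_simp; ring
  rw [e2]
  linarith

theorem eLpNorm_negPart_le (h : IsSelfBounding μ A 0 M f u) (hA : 1 ≤ A) {q : ℝ} (hq : 0 < q) :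
    eLpNorm (fun x => max (-(f x - ∫ y, f y ∂(Measure.pi μ))) 0) (ENNReal.ofReal q)
      (Measure.pi μ) ≤ ENNReal.ofReal (Real.sqrt (q * A * ∫ x, f x ∂(Measure.pi μ))) := by
  set E := ∫ x, f x ∂(Measure.pi μ) with hE
  have hE0 : 0 ≤ E := integral_nonneg fun x => (h.mem_Icc x).1
  rcases hE0.eq_or_lt with hE1 | hE1
  · have : (fun x => max (-(f x - E)) 0) = fun _ => 0 := by
      funext x
      refine max_eq_right ?_
      linarith [(h.mem_Icc x).1]
    rw [this]
    simp
  set r := Real.sqrt (q * A * E) with hr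
  have hr0 : 0 < r := Real.sqrt_pos.2 (by positivity)
  have hr2 : r ^ 2 = q * A * E := Real.sq_sqrt (by positivity)
  -- The parameter `s = q/r` makes the quadratic term `A E s² / 2` equal to `q/2`.
  have hs0 : 0 < q / r := by positivity
  have hlog := h.log_mgf_neg_le le_rfl hA hs0
  have e1 : -E * (q / r * (1 - A / 2 * (q / r))) = -(q / r * E) + q / 2 := by
    have : E * (A / 2 * (q / r) ^ 2) = q / 2 := by
      rw [div_pow, hr2]; field_simp
    linear_combination this
  rw [e1] at hlog
  have hexp : ∫ x, Real.exp (q / r * -(f x - E)) ∂(Measure.pi μ) ≤ Real.exp (q / 2) := by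
    have e : ∀ x, Real.exp (q / r * -(f x - E))
        = Real.exp (q / r * E) * Real.exp (-(q / r) * f x) := fun x => by
      rw [← Real.exp_add]; ring_nf
    simp only [e]
    rw [integral_const_mul]
    change _ * mgf f (Measure.pi μ) (-(q / r)) ≤ _
    rw [← Real.exp_log (h.mgf_pos _), ← Real.exp_add, Real.exp_le_exp]
    linarith
  refine (eLpNorm_posPart_le_of_integral_exp_le (Y := fun x => -(f x - E))
    (h.measurable.sub_const E).neg
    (fun x => by rw [abs_neg]; exact h.abs_sub_integral_le x) hq hs0 hexp).trans
    (ENNReal.ofReal_le_ofReal ?_)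
  have e2 : q / (q / r) = r := by field_simp
  rw [e2]
  linarith

end IsSelfBounding

/-! ### Reduction to bounded functions. -/

/-- Changing one coordinate raises `F` by at most `1`, because `F ≤ u i + 1` at the new point and `u
i ≤ F` at the old one. Fixing a generic first coordinate reduces the dimension. -/
theorem exists_ae_le_of_sub_mem_Icc {S : Type*} [MeasurableSpace S] {n : ℕ}
    (μ : Fin n → Measure S) [∀ i, IsProbabilityMeasure (μ i)] (F : (Fin n → S) → ℝ)
    (u : Fin n → (Fin n → S) → ℝ) (hF : Measurable F)
    (hui : ∀ i x s, u i (Function.update x i s) = u i x)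
    (h : ∀ᵐ x ∂(Measure.pi μ), ∀ i, F x - u i x ∈ Set.Icc 0 1) :
    ∃ M, ∀ᵐ x ∂(Measure.pi μ), F x ≤ M := by
  induction n with
  | zero => exact ⟨F isEmptyElim, .of_forall fun x => by rw [Subsingleton.elim x]⟩
  | succ n ih =>
    have hmp := measurePreserving_cons μ
    have hc := hmp.measurable
    have h1 := Measure.ae_ae_of_ae_prod (hmp.quasiMeasurePreserving.ae h)
    obtain ⟨x₀, hx₀⟩ := h1.exists
    obtain ⟨M, hM⟩ := ih (fun j => μ j.succ) (fun y => F (Fin.cons x₀ y))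
      (fun i y => u i.succ (Fin.cons x₀ y)) (hF.comp (hc.comp measurable_prodMk_left))
      (fun i y s => by
        have := hui i.succ (Fin.cons x₀ y) s
        rwa [← Fin.cons_update] at this)
      (hx₀.mono fun y hy i => hy i.succ)
    refine ⟨M + 1, ?_⟩
    have hset : MeasurableSet {x | F x ≤ M + 1} := measurableSet_le hF measurable_const
    rw [← hmp.map_eq, ae_map_iff hc.aemeasurable hset]
    refine (Measure.ae_prod_iff_ae_ae (hc hset)).2 ?_
    filter_upwards [h1] with x hx
    filter_upwards [hx, hx₀, hM] with y hy hy₀ hMy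
    have e := hui 0 (Fin.cons x₀ y) x
    rw [Fin.update_cons_zero] at e
    have h2 := (hy 0).2
    have h3 := (hy₀ 0).1
    linarith

/-- Clamping to `[0, max 0 M]` leaves `F` unchanged almost everywhere and replaces `u i` by its
positive part, still at most `F`, so each difference can only shrink and stays nonnegative. -/
theorem exists_isSelfBounding_ae_eq {S : Type*} [MeasurableSpace S] {n : ℕ}
    {μ : Fin n → Measure S} [∀ i, IsProbabilityMeasure (μ i)] {A : ℝ} (hA : 0 < A)
    {F : (Fin n → S) → ℝ} {u : Fin n → (Fin n → S) → ℝ} (hF : Measurable F)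
    (hu : ∀ i, Measurable (u i)) (hui : ∀ i x s, u i (Function.update x i s) = u i x)
    (h : ∀ᵐ x ∂(Measure.pi μ), ∀ i, F x - u i x ∈ Set.Icc 0 1)
    (hsum : ∀ᵐ x ∂(Measure.pi μ), ∑ i, (F x - u i x) ≤ A * F x) :
    ∃ M f v, IsSelfBounding μ A 0 M f v ∧ F =ᵐ[Measure.pi μ] f := by
  obtain ⟨M, hM⟩ := exists_ae_le_of_sub_mem_Icc μ F u hF hui h
  have hclamp : ∀ z : ℝ, max 0 (min z (max 0 M)) ∈ Set.Icc 0 (max 0 M) := fun z =>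
    ⟨le_max_left _ _, max_le (le_max_left _ _) (min_le_right _ _)⟩
  have hF0 : ∀ᵐ x ∂(Measure.pi μ), 0 ≤ F x := by
    filter_upwards [h, hsum] with x h1 h2
    exact nonneg_of_mul_nonneg_right ((Finset.sum_nonneg fun i _ => (h1 i).1).trans h2) hA
  have hFf : ∀ᵐ x ∂(Measure.pi μ), max 0 (min (F x) (max 0 M)) = F x := by
    filter_upwards [hM, hF0] with x h1 h2
    rw [min_eq_left (h1.trans (le_max_right _ _)), max_eq_right h2]
  have hlow : ∀ᵐ x ∂(Measure.pi μ), ∀ i, max 0 (min (u i x) (max 0 M)) = max 0 (u i x) := by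
    filter_upwards [hM, h] with x h1 h2 i
    rw [min_eq_left]
    exact le_max_of_le_right (by linarith [(h2 i).1])
  refine ⟨max 0 M, fun x => max 0 (min (F x) (max 0 M)),
    fun i x => max 0 (min (u i x) (max 0 M)), ⟨measurable_const.max (hF.min measurable_const),
    fun i => measurable_const.max ((hu i).min measurable_const), fun x => hclamp _,
    fun i x => hclamp _, fun i x s => by rw [hui], ?_, ?_⟩, hFf.mono fun x hx => hx.symm⟩
  · filter_upwards [h, hF0, hFf, hlow] with x h1 h2 h3 h4 i
    rw [h3, h4]
    exact ⟨by linarith [max_le h2 (sub_nonneg.1 (h1 i).1)],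
      by linarith [(h1 i).2, le_max_right 0 (u i x)]⟩
  · filter_upwards [hsum, hFf, hlow] with x h1 h2 h3
    simp only [h2, h3]
    refine le_trans (Finset.sum_le_sum fun i _ => ?_) h1
    linarith [le_max_right 0 (u i x)]

/-! ### Transfer to the original probability space. -/

theorem corollary1 :
    ∃ C : ℝ, 0 < C ∧ C < 1.131 ∧
      ∀ (Ω : Type*) [MeasurableSpace Ω] (P : Measure Ω) [IsProbabilityMeasure P]
        (S : Type*) [MeasurableSpace S] (n : ℕ)
        (X : Fin n → Ω → S) (F : (Fin n → S) → ℝ)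
        (Fdrop : (i : Fin n) → ({j : Fin n // j ≠ i} → S) → ℝ)
        (Z : Ω → ℝ) (Zdrop : Fin n → Ω → ℝ) (A : ℝ),
        (∀ i, Measurable (X i)) → iIndepFun X P →
        Measurable F → (∀ i, Measurable (Fdrop i)) →
        Z = fullValue F X → (∀ i, Zdrop i = leaveOneOutValue i (Fdrop i) X) →
        1 ≤ A →
        (∀ i, ∀ᵐ ω ∂P, 0 ≤ Z ω - Zdrop i ω ∧ Z ω - Zdrop i ω ≤ 1) →
        (∀ᵐ ω ∂P, 0 ≤ ∑ i, (Z ω - Zdrop i ω) ∧ ∑ i, (Z ω - Zdrop i ω) ≤ A * Z ω) →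
        (∀ q : ℕ, 1 ≤ q →
          eLpNorm Z q P ≤ ENNReal.ofReal ((∫ ω, Z ω ∂P) + A * (((q : ℝ) - 1) / 2))) ∧
        (∀ q : ℝ, 2 ≤ q →
          eLpNorm (fun ω => max (Z ω - ∫ ω', Z ω' ∂P) 0) (ENNReal.ofReal q) P ≤
            ENNReal.ofReal (Real.sqrt kappa *
              (Real.sqrt (A * q * ∫ ω, Z ω ∂P) + A * q / 2))) ∧
        (∀ q : ℕ, 2 ≤ q →
          eLpNorm (fun ω => max (-(Z ω - ∫ ω', Z ω' ∂P)) 0) q P ≤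
            ENNReal.ofReal (Real.sqrt (C * q * A * ∫ ω, Z ω ∂P))) := by
  refine ⟨1, one_pos, by norm_num, ?_⟩
  intro Ω _ P _ S _ n X F Fdrop Z Zdrop A hX hind hF hFdrop hZ hZdrop hA hdiff hsum
  have hA0 : 0 < A := by linarith
  set μ : Fin n → Measure S := fun i => P.map (X i) with hμ
  have hprob : ∀ i, IsProbabilityMeasure (μ i) := fun i =>
    Measure.isProbabilityMeasure_map (hX i).aemeasurable
  -- Independence enters only here: the joint law is a product measure.
  have hmap : P.map (fun ω i => X i ω) = Measure.pi μ :=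
    (iIndepFun_iff_map_fun_eq_pi_map fun i => (hX i).aemeasurable).1 hind
  have hXm : Measurable fun ω i => X i ω := measurable_pi_lambda _ hX
  have hmp : MeasurePreserving (fun ω i => X i ω) P (Measure.pi μ) := ⟨hXm, hmap⟩
  let u : Fin n → (Fin n → S) → ℝ := fun i x => Fdrop i fun j => x j.1
  have hu : ∀ i, Measurable (u i) := fun i =>
    (hFdrop i).comp (measurable_pi_lambda _ fun j => measurable_pi_apply _)
  have hui : ∀ i x s, u i (Function.update x i s) = u i x := fun i x s => by
    simp only [u]
    congr 1
    funext j
    exact Function.update_of_ne j.2 _ _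
  have hZω : ∀ ω, Z ω = F fun i => X i ω := fun ω => by rw [hZ]; rfl
  have hZdω : ∀ i ω, Zdrop i ω = u i fun i => X i ω := fun i ω => by rw [hZdrop]; rfl
  have hdiff' : ∀ᵐ x ∂(Measure.pi μ), ∀ i, F x - u i x ∈ Set.Icc 0 1 := by
    rw [ae_all_iff]
    intro i
    rw [← hmap]
    refine (ae_map_iff hXm.aemeasurable ((hF.sub (hu i)) measurableSet_Icc)).2 ?_
    filter_upwards [hdiff i] with ω hω
    rw [hZω, hZdω] at hω
    exact hω
  have hsum' : ∀ᵐ x ∂(Measure.pi μ), ∑ i, (F x - u i x) ≤ A * F x := by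
    have hset : MeasurableSet {x | ∑ i, (F x - u i x) ≤ A * F x} :=
      measurableSet_le (Finset.measurable_fun_sum _ fun i _ => hF.sub (hu i)) (hF.const_mul A)
    rw [← hmap, ae_map_iff hXm.aemeasurable hset]
    filter_upwards [hsum] with ω hω
    simpa only [hZω, hZdω] using hω.2
  obtain ⟨M, f, v, h, hFf⟩ := exists_isSelfBounding_ae_eq hA0 hF hu hui hdiff' hsum'
  have hZf : Z =ᵐ[P] fun ω => f fun i => X i ω := by
    filter_upwards [hmp.quasiMeasurePreserving.ae hFf] with ω hω
    rw [hZω, hω]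
  have hE : ∫ ω, Z ω ∂P = ∫ x, f x ∂(Measure.pi μ) := by
    rw [integral_congr_ae hZf, ← hmap,
      integral_map hXm.aemeasurable h.measurable.aestronglyMeasurable]
  have hnorm : ∀ (g : ℝ → ℝ) (p : ENNReal), Measurable g →
      eLpNorm (fun ω => g (Z ω)) p P = eLpNorm (fun x => g (f x)) p (Measure.pi μ) := by
    intro g p hg
    exact (eLpNorm_congr_ae (hZf.mono fun ω hω => congrArg g hω)).trans
      (eLpNorm_comp_measurePreserving (hg.comp h.measurable).aestronglyMeasurable hmp)
  rw [hE]
  refine ⟨fun q hq => ?_, fun q hq => ?_, fun q hq => ?_⟩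
  · rw [hnorm (fun z => z) q measurable_id]
    exact h.eLpNorm_le hA0.le hq
  · rw [hnorm (fun z => max (z - ∫ x, f x ∂(Measure.pi μ)) 0) _ (by fun_prop)]
    refine (h.eLpNorm_posPart_le hA0 (by linarith)).trans (ENNReal.ofReal_le_ofReal ?_)
    exact le_mul_of_one_le_left (add_nonneg (Real.sqrt_nonneg _) (by nlinarith)) one_le_sqrt_kappa
  · rw [hnorm (fun z => max (-(z - ∫ x, f x ∂(Measure.pi μ))) 0) _ (by fun_prop), one_mul,
      ← ENNReal.ofReal_natCast]
    exact h.eLpNorm_negPart_le hA (by positivity)
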